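/- Let $V_{k,n}=\{\Phi\in\mathbb C^{n\times k} : \Phi^\dagger\Phi=\mathbf 1\}$ be the complex Stiefel manifold, with the chordal distance $d^V(\Phi,\Psi)=\|\Phi-\Psi\|_F$. Equip $\mathfrak u(n)=\{X\in\mathbb C^{n\times n}: X^\dagger=-X\}$ with the inner product $\langle X,Y\rangle=\tfrac12\operatorname{tr}(X^\dagger Y)$. For $\Phi\in V_{k,n}$ call $X\in\mathfrak u(n)$ horizontal at $\Phi$ if $X$ is orthogonal to $\{W\in\mathfrak u(n): W\Phi=0\}$; every tangent vector $\xi$ of $V_{k,n}$ at $\Phi$ is $\xi=X\Phi$ for exactly one horizontal $X$, and the $U(n)$-normal homogeneous Riemannian metric is given by $|\xi|_\Phi=\tfrac1{\sqrt2}\|X\|_F$. (At $\Phi=\binom{\mathbf 1}{\mathbf 0}$ the horizontal elements are $X=\begin{pmatrix}A&-B^\dagger\\B&\mathbf 0\end{pmatrix}$ with $A\in\mathfrak u(k)$, $B\in\mathbb C^{(n-k)\times k}$, and $\tfrac12\|X\|_F^2=\tfrac12\|A\|_F^2+\|B\|_F^2$.) Let $r^V(\Phi,\Psi)\in[0,\infty]$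 be the geodesic distance of this metric, that is, the infimum of the lengths of the $C^1$ curves in $V_{k,n}$ from $\Psi$ to $\Phi$, and let $\ell^V(\Phi,\Psi)\in[0,\infty]$ be the infimum of the lengths $\tfrac1{\sqrt2}\|X\|_F$ of the geodesics $t\mapsto\exp(tX)\Psi$, $0\le t\le1$, with $X$ horizontal at $\Psi$ and $\exp(X)\Psi=\Phi$. For $k=n$ or $k\le n/2$ the distances $d^V$ and $r^V$ are locally equivalent. Precisely, for all $n,k\ge0$: (i) For all $\Phi,\Psi\in V_{k,n}$, $\ \tfrac1{\sqrt2}\,d^V(\Phi,\Psi)\le r^V(\Phi,\Psi)\le\ell^V(\Phi,\Psi)$. (ii) If $k=n$, then for all $\Phi,\Psi\in V_{k,n}$ both $r^V(\Phi,\Psi)$ and $\ell^V(\Phi,\Psi)$ are at most $\tfrac{\pi}{2\sqrt2}\,d^V(\Phi,\Psi)$. (iii) If $k\le n/2$, then for every $\alpha>\pi/2$ there is $\delta>0$ such that for all $\Phi,\Psi\in V_{k,n}$ with $d^V(\Phi,\Psi)\le\delta$ both $r^V(\Phi,\Psi)$ and $\ell^V(\Phi,\Psi)$ are at most $\alpha\,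 d^V(\Phi,\Psi)$. -/

import Mathlib

open MeasureTheory Set
open scoped ENNReal Matrix

attribute [local instance] Matrix.frobeniusNormedAddCommGroup Matrix.frobeniusNormedSpace

/-- The complex Stiefel manifold: the `n × k` complex matrices with orthonormal columns. -/
def stiefel (n k : ℕ) : Set (Matrix (Fin n) (Fin k) ℂ) := {Φ | Φᴴ * Φ = 1}

/-- The chordal distance `‖Φ - Ψ‖_F` (all matrix norms here are Frobenius norms). -/
noncomputable def chordalDist {n k : ℕ} (Φ Ψ : Matrix (Fin n) (Fin k) ℂ) : ℝ := ‖Φ - Ψ‖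

/-- The Lie algebra `𝔲(n)` of skew-Hermitian matrices. -/
def skewHermitian (n : ℕ) : Set (Matrix (Fin n) (Fin n) ℂ) := {X | Xᴴ = -X}

/-- The Lie algebra of the isotropy group `{U ∈ U(n) | U Φ = Φ}` of `Φ`. For
`Φ = [1; 0]` these are the matrices `[0, 0; 0, D]` with `D ∈ 𝔲(n - k)`. -/
def isotropyAlgebra {n k : ℕ} (Φ : Matrix (Fin n) (Fin k) ℂ) : Set (Matrix (Fin n) (Fin n) ℂ) :=
  {W | W ∈ skewHermitian n ∧ W * Φ = 0}

/-- The horizontal tangents at `Φ`: the orthogonal complement in `𝔲(n)` of the isotropy algebra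
for the bi-invariant inner product `⟨X, W⟩ = 1/2 tr (Xᴴ W)`. For `Φ = [1; 0]` these are the
matrices `[A, -Bᴴ; B, 0]` with `A ∈ 𝔲(k)`. -/
def horizontal {n k : ℕ} (Φ : Matrix (Fin n) (Fin k) ℂ) : Set (Matrix (Fin n) (Fin n) ℂ) :=
  {X | X ∈ skewHermitian n ∧ ∀ W ∈ isotropyAlgebra Φ, (1 / 2 : ℂ) * (Xᴴ * W).trace = 0}

/-- The length `(1/√2) ‖X‖_F` of `X ∈ 𝔲(n)` for the inner product `⟨X, Y⟩ = 1/2 tr (Xᴴ Y)`. -/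
noncomputable def algebraNorm {n : ℕ} (X : Matrix (Fin n) (Fin n) ℂ) : ℝ := ‖X‖ / √2

/-- The normal homogeneous Riemannian metric: the length of a tangent vector `ξ` of the Stiefel
manifold at `Φ` is the length of the horizontal `X ∈ 𝔲(n)` that generates it, `X Φ = ξ`. There is
exactly one such `X` if `ξ` is tangent (`existsUnique_horizontal`); the value is `⊤` otherwise. -/
noncomputable def tangentNorm {n k : ℕ} (Φ ξ : Matrix (Fin n) (Fin k) ℂ) : ℝ≥0∞ :=
  ⨅ X ∈ {X | X ∈ horizontal Φ ∧ X * Φ = ξ}, ENNReal.ofReal (algebraNorm X)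

/-- The `C¹` curves `[0, 1] → stiefel n k` from `Ψ` to `Φ`. -/
def stiefelCurves {n k : ℕ} (Ψ Φ : Matrix (Fin n) (Fin k) ℂ) :
    Set (ℝ → Matrix (Fin n) (Fin k) ℂ) :=
  {γ | ContDiffOn ℝ 1 γ (Icc 0 1) ∧ (∀ t ∈ Icc (0 : ℝ) 1, γ t ∈ stiefel n k) ∧
    γ 0 = Ψ ∧ γ 1 = Φ}

/-- The length of a curve for the normal homogeneous metric. -/
noncomputable def curveLength {n k : ℕ} (γ : ℝ → Matrix (Fin n) (Fin k) ℂ) : ℝ≥0∞ :=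
  ∫⁻ t in Icc (0 : ℝ) 1, tangentNorm (γ t) (derivWithin γ (Icc 0 1) t)

/-- The geodesic (Riemannian) distance of the normal homogeneous metric: the infimum of the
lengths of the `C¹` curves joining the two points. -/
noncomputable def geodesicDist {n k : ℕ} (Φ Ψ : Matrix (Fin n) (Fin k) ℂ) : ℝ≥0∞ :=
  ⨅ γ ∈ stiefelCurves Ψ Φ, curveLength γ

/-- The infimum of the lengths of the geodesics `t ↦ exp (t X) Ψ`, `X` horizontal at `Ψ`, that
join `Ψ` to `Φ = exp (X) Ψ`; `⊤` if there is no such geodesic. -/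
noncomputable def shortestGeodesic {n k : ℕ} (Φ Ψ : Matrix (Fin n) (Fin k) ℂ) : ℝ≥0∞ :=
  ⨅ X ∈ {X | X ∈ horizontal Ψ ∧ NormedSpace.exp X * Ψ = Φ}, ENNReal.ofReal (algebraNorm X)

open scoped ComplexOrder in
/-- A horizontal element is determined by the tangent vector it generates. -/
theorem horizontal_eq_of_mul_eq {n k : ℕ} {Φ : Matrix (Fin n) (Fin k) ℂ}
    {X Y : Matrix (Fin n) (Fin n) ℂ} (hX : X ∈ horizontal Φ) (hY : Y ∈ horizontal Φ)
    (h : X * Φ = Y * Φ) : X = Y := by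
  have hX1 : Xᴴ = -X := hX.1
  have hY1 : Yᴴ = -Y := hY.1
  have hD : X - Y ∈ isotropyAlgebra Φ := by
    refine ⟨?_, by rw [Matrix.sub_mul, h, sub_self]⟩
    change (X - Y)ᴴ = -(X - Y)
    rw [Matrix.conjTranspose_sub, hX1, hY1]
    abel
  have h1 := hX.2 _ hD
  have h2 := hY.2 _ hD
  have h3 : ((X - Y)ᴴ * (X - Y)).trace = 0 := by
    rw [Matrix.conjTranspose_sub, Matrix.sub_mul, Matrix.trace_sub]
    linear_combination 2 * h1 - 2 * h2
  exact sub_eq_zero.mp (Matrix.trace_conjTranspose_mul_self_eq_zero_iff.mp h3)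

/-- Every tangent vector `ξ` of the Stiefel manifold at `Φ` (that is, `Φᴴ ξ` is skew-Hermitian)
is generated by exactly one horizontal element of `𝔲(n)`. -/
theorem existsUnique_horizontal {n k : ℕ} {Φ ξ : Matrix (Fin n) (Fin k) ℂ}
    (hΦ : Φ ∈ stiefel n k) (hξ : (Φᴴ * ξ)ᴴ = -(Φᴴ * ξ)) :
    ∃! X, X ∈ horizontal Φ ∧ X * Φ = ξ := by
  refine existsUnique_of_exists_of_unique ?_
    (fun X Y hX hY => horizontal_eq_of_mul_eq hX.1 hY.1 (hX.2.trans hY.2.symm))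
  have h1 : Φᴴ * Φ = 1 := hΦ
  have hξ' : ξᴴ * Φ = -(Φᴴ * ξ) := by simpa using hξ
  refine ⟨ξ * Φᴴ - Φ * ξᴴ - Φ * (Φᴴ * ξ) * Φᴴ, ⟨?_, ?_⟩, ?_⟩
  · have h3 : (Φ * (Φᴴ * ξ) * Φᴴ)ᴴ = -(Φ * (Φᴴ * ξ) * Φᴴ) := by
      rw [Matrix.conjTranspose_mul, Matrix.conjTranspose_mul, hξ]
      simp [Matrix.mul_assoc]
    change _ᴴ = -_
    rw [Matrix.conjTranspose_sub, Matrix.conjTranspose_sub, h3]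
    simp only [Matrix.conjTranspose_mul, Matrix.conjTranspose_conjTranspose]
    abel
  · rintro W ⟨hW, hWΦ⟩
    have hW' : Wᴴ = -W := hW
    have hΦW : Φᴴ * W = 0 := by
      have := congrArg Matrix.conjTranspose hWΦ
      simpa [hW'] using this
    simp only [Matrix.conjTranspose_sub, Matrix.conjTranspose_mul,
      Matrix.conjTranspose_conjTranspose, Matrix.sub_mul, Matrix.trace_sub]
    have e1 : (Φ * ξᴴ * W).trace = 0 := by
      rw [Matrix.mul_assoc, Matrix.trace_mul_comm, Matrix.mul_assoc, hWΦ]; simp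
    have e2 : (ξ * Φᴴ * W).trace = 0 := by
      rw [Matrix.mul_assoc, hΦW]; simp
    have e3 : (Φ * (ξᴴ * Φ * Φᴴ) * W).trace = 0 := by
      rw [Matrix.mul_assoc, Matrix.mul_assoc, hΦW]; simp
    rw [e1, e2, e3]; simp
  · rw [Matrix.sub_mul, Matrix.sub_mul, Matrix.mul_assoc, h1, Matrix.mul_assoc, hξ',
      Matrix.mul_assoc, h1]
    simp

/-! ### Frobenius norms under partial isometries -/

section FrobeniusNorm

variable {m n k : ℕ}

/-! Since `‖X * Φ‖ ≤ ‖X‖`, the metric is at least `1/√2` times the Euclidean one, and no curve is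
shorter than its chord. Conversely, a horizontal `X` stays horizontal along `exp (t X) Ψ`, so that
curve has constant speed and competes in the infimum defining `geodesicDist`. Upper bounds are thus
needed only for `shortestGeodesic`: given `Φ` and `Ψ`, find a small horizontal `X` with `exp X * Ψ =
Φ`.

For `k = n` every skew-Hermitian matrix is horizontal, and `X` is the principal logarithm of `Φ *
Ψᴴ`. On the unit circle an arc is at most `π/2` times its chord; functional calculus and the trace
carry this over to Frobenius norms (`exists_skewHermitian_log`).

For the local bound, a quantitative inverse function argument in the ambient matrix space, uniform
in `Ψ`, solves `exp X * Ψ * (1 + S) = Φ` with `S` a small Hermitian matrix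
(`exists_geodesicChart_eq`). If `Φ` has orthonormal columns, then `S = 0`. Linearizing `exp` gives
`‖X‖ ≤ 32/15 * ‖Φ - Ψ‖`, and `32 / (15 √2) < π / 2`. -/

theorem frobenius_norm_sq_eq_trace (A : Matrix (Fin m) (Fin n) ℂ) :
    ‖A‖ ^ 2 = (Aᴴ * A).trace.re := by
  rw [Matrix.frobenius_norm_def, ← Real.sqrt_eq_rpow, Real.sq_sqrt (by positivity),
    Finset.sum_comm]
  simp [Matrix.trace, Matrix.mul_apply, Complex.sq_norm, Complex.normSq_apply]

theorem frobenius_norm_eq_of_gram_eq {m' : ℕ} {A : Matrix (Fin m) (Fin n) ℂ}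
    {B : Matrix (Fin m') (Fin n) ℂ} (h : Aᴴ * A = Bᴴ * B) : ‖A‖ = ‖B‖ := by
  have : ‖A‖ ^ 2 = ‖B‖ ^ 2 := by rw [frobenius_norm_sq_eq_trace, frobenius_norm_sq_eq_trace, h]
  exact (sq_eq_sq₀ (norm_nonneg _) (norm_nonneg _)).mp this

theorem norm_stiefel_mul {Φ : Matrix (Fin n) (Fin k) ℂ} (hΦ : Φ ∈ stiefel n k)
    (A : Matrix (Fin k) (Fin m) ℂ) : ‖Φ * A‖ = ‖A‖ := by
  have h1 : Φᴴ * Φ = 1 := hΦ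
  apply frobenius_norm_eq_of_gram_eq
  rw [Matrix.conjTranspose_mul, Matrix.mul_assoc, ← Matrix.mul_assoc Φᴴ, h1, Matrix.one_mul]

theorem norm_mul_stiefel_conjTranspose {Φ : Matrix (Fin n) (Fin k) ℂ} (hΦ : Φ ∈ stiefel n k)
    (A : Matrix (Fin m) (Fin k) ℂ) : ‖A * Φᴴ‖ = ‖A‖ := by
  rw [← Matrix.frobenius_norm_conjTranspose, Matrix.conjTranspose_mul,
    Matrix.conjTranspose_conjTranspose, norm_stiefel_mul hΦ, Matrix.frobenius_norm_conjTranspose]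

/-- Pythagoras for the projection onto the column space of `Φ`. -/
theorem norm_sq_stiefel_decomp {Φ : Matrix (Fin n) (Fin k) ℂ} (hΦ : Φ ∈ stiefel n k)
    (A : Matrix (Fin n) (Fin m) ℂ) : ‖Φᴴ * A‖ ^ 2 + ‖A - Φ * (Φᴴ * A)‖ ^ 2 = ‖A‖ ^ 2 := by
  have h1 : Φᴴ * Φ = 1 := hΦ
  have h2 : (A - Φ * (Φᴴ * A))ᴴ * (A - Φ * (Φᴴ * A)) = Aᴴ * A - (Φᴴ * A)ᴴ * (Φᴴ * A) := by
    have h3 : Aᴴ * Φ * Φᴴ * (Φ * (Φᴴ * A)) = Aᴴ * Φ * (Φᴴ * A) := by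
      rw [Matrix.mul_assoc _ Φᴴ, ← Matrix.mul_assoc Φᴴ, h1, Matrix.one_mul]
    simp only [Matrix.conjTranspose_sub, Matrix.conjTranspose_mul,
      Matrix.conjTranspose_conjTranspose, Matrix.sub_mul, Matrix.mul_sub, h3]
    simp only [Matrix.mul_assoc]
    abel
  rw [frobenius_norm_sq_eq_trace, frobenius_norm_sq_eq_trace, h2, frobenius_norm_sq_eq_trace,
    Matrix.trace_sub, Complex.sub_re]
  ring

theorem norm_stiefel_conjTranspose_mul_le {Φ : Matrix (Fin n) (Fin k) ℂ} (hΦ : Φ ∈ stiefel n k)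
    (A : Matrix (Fin n) (Fin m) ℂ) : ‖Φᴴ * A‖ ≤ ‖A‖ := by
  refine (sq_le_sq₀ (norm_nonneg _) (norm_nonneg _)).mp ?_
  nlinarith [norm_sq_stiefel_decomp hΦ A, sq_nonneg ‖A - Φ * (Φᴴ * A)‖]

theorem norm_sub_stiefel_proj_le {Φ : Matrix (Fin n) (Fin k) ℂ} (hΦ : Φ ∈ stiefel n k)
    (A : Matrix (Fin n) (Fin m) ℂ) : ‖A - Φ * (Φᴴ * A)‖ ≤ ‖A‖ := by
  refine (sq_le_sq₀ (norm_nonneg _) (norm_nonneg _)).mp ?_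
  nlinarith [norm_sq_stiefel_decomp hΦ A, sq_nonneg ‖Φᴴ * A‖]

theorem norm_mul_stiefel_le {Φ : Matrix (Fin n) (Fin k) ℂ} (hΦ : Φ ∈ stiefel n k)
    (A : Matrix (Fin m) (Fin n) ℂ) : ‖A * Φ‖ ≤ ‖A‖ := by
  rw [← Matrix.frobenius_norm_conjTranspose, Matrix.conjTranspose_mul,
    ← Matrix.frobenius_norm_conjTranspose A]
  exact norm_stiefel_conjTranspose_mul_le hΦ _

end FrobeniusNorm

/-! ### The exponential of a skew-Hermitian matrix and its orbits -/

section Exponential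

variable {n k : ℕ}

theorem conjTranspose_exp_mul_exp {X : Matrix (Fin n) (Fin n) ℂ} (hX : X ∈ skewHermitian n) :
    (NormedSpace.exp X)ᴴ * NormedSpace.exp X = 1 := by
  have hX' : Xᴴ = -X := hX
  have h : NormedSpace.exp Xᴴ = (NormedSpace.exp X)ᴴ := Matrix.exp_conjTranspose X
  rw [← h, hX', Matrix.exp_neg]
  exact Matrix.nonsing_inv_mul _ ((Matrix.isUnit_iff_isUnit_det _).mp (Matrix.isUnit_exp X))

theorem exp_mul_mem_stiefel {X : Matrix (Fin n) (Fin n) ℂ} (hX : X ∈ skewHermitian n)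
    {Ψ : Matrix (Fin n) (Fin k) ℂ} (hΨ : Ψ ∈ stiefel n k) :
    NormedSpace.exp X * Ψ ∈ stiefel n k := by
  have h1 : Ψᴴ * Ψ = 1 := hΨ
  change (NormedSpace.exp X * Ψ)ᴴ * (NormedSpace.exp X * Ψ) = 1
  rw [Matrix.conjTranspose_mul, Matrix.mul_assoc, ← Matrix.mul_assoc _ᴴ (NormedSpace.exp X),
    conjTranspose_exp_mul_exp hX, Matrix.one_mul, h1]

/-- Strict differentiability of `exp` at `0`, with the identity as derivative. -/
theorem exp_matrix_approximates {c : ℝ} (hc : 0 < c) : ∃ ε > 0,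
    ∀ X Y : Matrix (Fin n) (Fin n) ℂ, ‖X‖ ≤ ε → ‖Y‖ ≤ ε →
      ‖NormedSpace.exp X - NormedSpace.exp Y - (X - Y)‖ ≤ c * ‖X - Y‖ := by
  let := Matrix.frobeniusNormedRing (m := Fin n) (α := ℂ)
  let := Matrix.frobeniusNormedAlgebra (m := Fin n) (R := ℂ) (α := ℂ)
  have h := hasStrictFDerivAt_exp_zero (𝕂 := ℂ) (𝔸 := Matrix (Fin n) (Fin n) ℂ)
  have h2 := h.isLittleO.def hc
  obtain ⟨ε, hε, h3⟩ := Metric.eventually_nhds_iff.mp h2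
  refine ⟨ε / 2, by positivity, fun X Y hX hY => ?_⟩
  have := @h3 (X, Y) (by
    rw [Prod.dist_eq]
    refine max_lt ?_ ?_
    · exact (dist_zero_right X).trans_lt (hX.trans_lt (by linarith))
    · exact (dist_zero_right Y).trans_lt (hY.trans_lt (by linarith)))
  exact this

theorem hasDerivAt_exp_smul_mul (X : Matrix (Fin n) (Fin n) ℂ) (Ψ : Matrix (Fin n) (Fin k) ℂ)
    (t : ℝ) : HasDerivAt (fun s : ℝ => NormedSpace.exp (s • X) * Ψ)
      (X * (NormedSpace.exp (t • X) * Ψ)) t := by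
  let := Matrix.frobeniusNormedRing (m := Fin n) (α := ℂ)
  let := Matrix.frobeniusNormedAlgebra (m := Fin n) (R := ℝ) (α := ℂ)
  have h := hasDerivAt_exp_smul_const' (𝕂 := ℝ) X t
  let L : Matrix (Fin n) (Fin n) ℂ →ₗ[ℝ] Matrix (Fin n) (Fin k) ℂ :=
    { toFun := fun A => A * Ψ
      map_add' := fun A B => Matrix.add_mul _ _ _
      map_smul' := fun c A => Matrix.smul_mul _ _ _ }
  have h2 := (LinearMap.toContinuousLinearMap L).hasFDerivAt.comp_hasDerivAt t h
  rw [← Matrix.mul_assoc]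
  exact h2

theorem contDiff_exp_smul_mul (X : Matrix (Fin n) (Fin n) ℂ) (Ψ : Matrix (Fin n) (Fin k) ℂ) :
    ContDiff ℝ 1 (fun s : ℝ => NormedSpace.exp (s • X) * Ψ) := by
  rw [contDiff_one_iff_deriv]
  have hdiff : Differentiable ℝ (fun s : ℝ => NormedSpace.exp (s • X) * Ψ) :=
    fun t => (hasDerivAt_exp_smul_mul X Ψ t).differentiableAt
  refine ⟨hdiff, ?_⟩
  exact (continuous_const.matrix_mul hdiff.continuous).congr
    fun t => (hasDerivAt_exp_smul_mul X Ψ t).deriv.symm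

end Exponential

/-! ### Horizontal elements and lifts -/

section Horizontal

variable {n k : ℕ}

/-- A horizontal element stays horizontal along the orbit of its one-parameter group. -/
theorem horizontal_exp_smul_mul {X : Matrix (Fin n) (Fin n) ℂ} {Ψ : Matrix (Fin n) (Fin k) ℂ}
    (hX : X ∈ horizontal Ψ) (t : ℝ) : X ∈ horizontal (NormedSpace.exp (t • X) * Ψ) := by
  refine ⟨hX.1, ?_⟩
  rintro W ⟨hW, hWΨ⟩
  have hX1 : Xᴴ = -X := hX.1
  have hW1 : Wᴴ = -W := hW
  have htX : t • X ∈ skewHermitian n := by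
    change (t • X)ᴴ = -(t • X)
    rw [Matrix.conjTranspose_smul, hX1]
    simp
  set E := NormedSpace.exp (t • X) with hE
  have hEE : Eᴴ * E = 1 := conjTranspose_exp_mul_exp htX
  have hEE' : E * Eᴴ = 1 := mul_eq_one_comm.mp hEE
  have hcomm : E * X = X * E := by
    have : Commute (t • X) X := (Commute.refl X).smul_left t
    exact this.exp_left
  -- Conjugation by `E` carries isotropy at `Ψ` to isotropy at `E * Ψ`; it preserves the trace form
  -- and fixes `X`, which commutes with `E`.
  have hmem : Eᴴ * W * E ∈ isotropyAlgebra Ψ := by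
    refine ⟨?_, ?_⟩
    · change (Eᴴ * W * E)ᴴ = -(Eᴴ * W * E)
      simp [hW1, Matrix.mul_assoc]
    · rw [Matrix.mul_assoc, Matrix.mul_assoc, hWΨ, Matrix.mul_zero]
  have h := hX.2 _ hmem
  have h2 : (Xᴴ * (Eᴴ * W * E)).trace = (Xᴴ * W).trace := by
    rw [← Matrix.mul_assoc, Matrix.trace_mul_comm, hX1]
    have : E * (-X * (Eᴴ * W)) = -X * W := by
      rw [← Matrix.mul_assoc, Matrix.mul_neg, hcomm, Matrix.neg_mul, Matrix.neg_mul,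
        Matrix.mul_assoc X, ← Matrix.mul_assoc E, hEE', Matrix.one_mul]
    rw [this]
  rwa [h2] at h

/-- The horizontal element of `𝔲(n)` generating the tangent vector `ξ` at `Φ`. -/
noncomputable def horizontalLift (Φ ξ : Matrix (Fin n) (Fin k) ℂ) : Matrix (Fin n) (Fin n) ℂ :=
  (ξ - Φ * (Φᴴ * ξ)) * Φᴴ - Φ * ξᴴ

theorem horizontalLift_sub (Φ ξ η : Matrix (Fin n) (Fin k) ℂ) :
    horizontalLift Φ (ξ - η) = horizontalLift Φ ξ - horizontalLift Φ η := by
  simp only [horizontalLift, Matrix.conjTranspose_sub, Matrix.mul_sub, Matrix.sub_mul]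
  abel

theorem norm_horizontalLift_le {Φ : Matrix (Fin n) (Fin k) ℂ} (hΦ : Φ ∈ stiefel n k)
    (ξ : Matrix (Fin n) (Fin k) ℂ) : ‖horizontalLift Φ ξ‖ ≤ 2 * ‖ξ‖ := by
  calc ‖horizontalLift Φ ξ‖ ≤ ‖(ξ - Φ * (Φᴴ * ξ)) * Φᴴ‖ + ‖Φ * ξᴴ‖ := norm_sub_le _ _
    _ ≤ ‖ξ‖ + ‖ξ‖ := by
      rw [norm_mul_stiefel_conjTranspose hΦ, norm_stiefel_mul hΦ,
        Matrix.frobenius_norm_conjTranspose]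
      gcongr
      exact norm_sub_stiefel_proj_le hΦ ξ
    _ = 2 * ‖ξ‖ := by ring

theorem horizontalLift_mul {Φ ξ : Matrix (Fin n) (Fin k) ℂ} (hΦ : Φ ∈ stiefel n k)
    (hξ : (Φᴴ * ξ)ᴴ = -(Φᴴ * ξ)) : horizontalLift Φ ξ * Φ = ξ := by
  have h1 : Φᴴ * Φ = 1 := hΦ
  have hξ' : ξᴴ * Φ = -(Φᴴ * ξ) := by simpa using hξ
  rw [horizontalLift, Matrix.sub_mul, Matrix.mul_assoc, h1, Matrix.mul_assoc, hξ']
  simp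

theorem horizontalLift_mem_horizontal {Φ ξ : Matrix (Fin n) (Fin k) ℂ}
    (hξ : (Φᴴ * ξ)ᴴ = -(Φᴴ * ξ)) : horizontalLift Φ ξ ∈ horizontal Φ := by
  refine ⟨?_, ?_⟩
  · have h3 : (Φ * (Φᴴ * ξ) * Φᴴ)ᴴ = -(Φ * (Φᴴ * ξ) * Φᴴ) := by
      rw [Matrix.conjTranspose_mul, Matrix.conjTranspose_mul, hξ]
      simp [Matrix.mul_assoc]
    change _ᴴ = -_
    rw [horizontalLift, Matrix.sub_mul, Matrix.conjTranspose_sub, Matrix.conjTranspose_sub, h3]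
    simp only [Matrix.conjTranspose_mul, Matrix.conjTranspose_conjTranspose]
    abel
  · rintro W ⟨hW, hWΦ⟩
    have hW' : Wᴴ = -W := hW
    have hΦW : Φᴴ * W = 0 := by
      have := congrArg Matrix.conjTranspose hWΦ
      simpa [hW'] using this
    have e1 : (Φ * (ξ - Φ * (Φᴴ * ξ))ᴴ * W).trace = 0 := by
      rw [Matrix.mul_assoc, Matrix.trace_mul_comm, Matrix.mul_assoc, hWΦ]; simp
    have e2 : (ξ * Φᴴ * W).trace = 0 := by
      rw [Matrix.mul_assoc, hΦW]; simp
    rw [horizontalLift, Matrix.conjTranspose_sub, Matrix.conjTranspose_mul,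
      Matrix.conjTranspose_mul, Matrix.conjTranspose_conjTranspose,
      Matrix.conjTranspose_conjTranspose, Matrix.sub_mul, Matrix.trace_sub, e1, e2]
    simp

end Horizontal

/-! ### Chord, geodesic distance and shortest geodesic -/

section Comparison

variable {n k : ℕ}

theorem enorm_le_tangentNorm {Φ : Matrix (Fin n) (Fin k) ℂ} (hΦ : Φ ∈ stiefel n k)
    (ξ : Matrix (Fin n) (Fin k) ℂ) : ENNReal.ofReal (1 / √2) * ‖ξ‖ₑ ≤ tangentNorm Φ ξ := by
  refine le_iInf₂ fun X hX => ?_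
  obtain ⟨-, rfl⟩ := hX
  rw [← ofReal_norm, ← ENNReal.ofReal_mul (by positivity)]
  refine ENNReal.ofReal_le_ofReal ?_
  rw [algebraNorm, one_div_mul_eq_div]
  gcongr
  exact norm_mul_stiefel_le hΦ X

theorem chordalDist_le_geodesicDist (Φ Ψ : Matrix (Fin n) (Fin k) ℂ) :
    ENNReal.ofReal (1 / √2 * chordalDist Φ Ψ) ≤ geodesicDist Φ Ψ := by
  refine le_iInf₂ fun γ hγ => ?_
  obtain ⟨hγ1, hγ2, rfl, rfl⟩ := hγ
  rw [chordalDist, ENNReal.ofReal_mul (by positivity), ofReal_norm]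
  calc ENNReal.ofReal (1 / √2) * ‖γ 1 - γ 0‖ₑ
      ≤ ENNReal.ofReal (1 / √2) * ∫⁻ t in Icc (0 : ℝ) 1, ‖derivWithin γ (Icc 0 1) t‖ₑ := by
        gcongr
        exact enorm_sub_le_lintegral_derivWithin_Icc_of_contDiffOn_Icc hγ1 zero_le_one
    _ = ∫⁻ t in Icc (0 : ℝ) 1, ENNReal.ofReal (1 / √2) * ‖derivWithin γ (Icc 0 1) t‖ₑ :=
        (lintegral_const_mul' _ _ ENNReal.ofReal_ne_top).symm
    _ ≤ curveLength γ :=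
        setLIntegral_mono' measurableSet_Icc fun t ht => enorm_le_tangentNorm (hγ2 t ht) _

/-- The same `X` is horizontal at every point of its orbit and generates the velocity there, so it
bounds the speed at all times. -/
theorem geodesicDist_le_shortestGeodesic (Φ : Matrix (Fin n) (Fin k) ℂ)
    {Ψ : Matrix (Fin n) (Fin k) ℂ} (hΨ : Ψ ∈ stiefel n k) :
    geodesicDist Φ Ψ ≤ shortestGeodesic Φ Ψ := by
  refine le_iInf₂ fun X hX => ?_
  obtain ⟨hX, rfl⟩ := hX
  have hX1 : Xᴴ = -X := hX.1
  have hmem : (fun t : ℝ => NormedSpace.exp (t • X) * Ψ) ∈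
      stiefelCurves Ψ (NormedSpace.exp X * Ψ) := by
    refine ⟨(contDiff_exp_smul_mul X Ψ).contDiffOn, fun t _ => ?_, by simp, by simp⟩
    refine exp_mul_mem_stiefel ?_ hΨ
    change (t • X)ᴴ = -(t • X)
    rw [Matrix.conjTranspose_smul, hX1]
    simp
  refine (iInf₂_le _ hmem).trans ?_
  calc curveLength (fun t : ℝ => NormedSpace.exp (t • X) * Ψ)
      ≤ ∫⁻ _ in Icc (0 : ℝ) 1, ENNReal.ofReal (algebraNorm X) := by
        refine setLIntegral_mono' measurableSet_Icc fun t ht => ?_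
        refine iInf₂_le X ⟨horizontal_exp_smul_mul hX t, ?_⟩
        exact ((hasDerivAt_exp_smul_mul X Ψ t).hasDerivWithinAt.derivWithin
          (uniqueDiffOn_Icc_zero_one t ht)).symm
    _ = ENNReal.ofReal (algebraNorm X) := by simp

theorem shortestGeodesic_le_of_exp_mul {X : Matrix (Fin n) (Fin n) ℂ}
    {Φ Ψ : Matrix (Fin n) (Fin k) ℂ} (hX : X ∈ horizontal Ψ) (h : NormedSpace.exp X * Ψ = Φ)
    {c : ℝ} (hc : ‖X‖ ≤ √2 * c) : shortestGeodesic Φ Ψ ≤ ENNReal.ofReal c := by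
  refine (iInf₂_le X ⟨hX, h⟩).trans (ENNReal.ofReal_le_ofReal ?_)
  rw [algebraNorm, div_le_iff₀' (by positivity)]
  exact hc

end Comparison

/-! ### Logarithms of unitaries and the case `k = n` -/

section UnitaryLogarithm

theorem Complex.norm_log_le_of_norm_eq_one {z : ℂ} (hz : ‖z‖ = 1) :
    ‖Complex.log z‖ ≤ Real.pi / 2 * ‖z - 1‖ := by
  have h0 : z ≠ 0 := by rintro rfl; simp at hz
  have h1 : Complex.log z = z.arg * Complex.I := by simp [Complex.log, hz]
  rw [h1, norm_mul, Complex.norm_I, mul_one, Complex.norm_real, Real.norm_eq_abs,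
    ← Complex.angle_one_right h0]
  exact Complex.angle_le_mul_norm_sub hz (by simp)

/-- A unitary with finite spectrum has a skew-adjoint logarithm `x`, and `x⋆ x` is dominated by
`(π/2)² (u - 1)⋆ (u - 1)`. -/
theorem exists_skewAdjoint_log_of_mem_unitary {A : Type*} [CStarAlgebra A] {u : A}
    (hu : u ∈ unitary A) (hfin : (spectrum ℂ u).Finite) :
    ∃ x g : A, star x = -x ∧ NormedSpace.exp x = u ∧
      star x * x + star g * g = ((Real.pi / 2) ^ 2 : ℂ) • (star (u - 1) * (u - 1)) := by
  have hn : IsStarNormal u := isStarNormal_of_mem_unitary hu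
  have hnorm : ∀ z ∈ spectrum ℂ u, ‖z‖ = 1 := fun z hz => by
    simpa using spectrum.subset_circle_of_unitary hu hz
  -- Finiteness of the spectrum makes the branch cut of `log` at `-1` harmless.
  have hcont : ∀ f : ℂ → ℂ, ContinuousOn f (spectrum ℂ u) := fun f => hfin.continuousOn f
  -- The slack in the arc-chord inequality; its square root provides `g`, so domination becomes an
  -- identity free of any norm or order.
  let r : ℂ → ℝ := fun z => √((Real.pi / 2 * ‖z - 1‖) ^ 2 - ‖Complex.log z‖ ^ 2)
  have hid : u - 1 = cfc (fun z : ℂ => z - 1) u := by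
    rw [cfc_sub (fun z : ℂ => z) (fun _ => 1) u (hcont _) (hcont _), cfc_id' ℂ u, cfc_const_one ℂ u]
  refine ⟨cfc Complex.log u, cfc (fun z => (r z : ℂ)) u, ?_, ?_, ?_⟩
  · rw [← cfc_star, ← cfc_neg]
    refine cfc_congr fun z hz => ?_
    apply Complex.ext <;> simp [Complex.log_re, hnorm z hz]
  · rw [← CFC.complex_exp_eq_normedSpace_exp (cfc_predicate _ _),
      ← cfc_comp' Complex.exp Complex.log u (Complex.continuous_exp.continuousOn) (hcont _)]
    conv_rhs => rw [← cfc_id' ℂ u]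
    refine cfc_congr fun z hz => Complex.exp_log ?_
    rintro rfl
    simpa using hnorm 0 hz
  · rw [hid, ← cfc_star, ← cfc_star, ← cfc_star, ← cfc_mul _ _ u (hcont _) (hcont _),
      ← cfc_mul _ _ u (hcont _) (hcont _), ← cfc_mul _ _ u (hcont _) (hcont _),
      ← cfc_add u _ _ (hcont _) (hcont _), ← cfc_smul _ _ u (hcont _)]
    refine cfc_congr fun z hz => ?_
    have hr : r z ^ 2 = (Real.pi / 2 * ‖z - 1‖) ^ 2 - ‖Complex.log z‖ ^ 2 := by
      refine Real.sq_sqrt (sub_nonneg.mpr ?_)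
      gcongr
      exact Complex.norm_log_le_of_norm_eq_one (hnorm z hz)
    have e : ∀ w : ℂ, star w * w = ((‖w‖ ^ 2 : ℝ) : ℂ) := fun w => by
      rw [Complex.star_def, Complex.conj_mul']; simp
    simp only [e, Complex.norm_real, Real.norm_eq_abs, sq_abs, smul_eq_mul]
    rw [hr]
    push_cast
    ring

theorem exists_skewHermitian_log {n : ℕ} {U : Matrix (Fin n) (Fin n) ℂ} (hU : Uᴴ * U = 1) :
    ∃ X ∈ skewHermitian n, NormedSpace.exp X = U ∧ ‖X‖ ≤ Real.pi / 2 * ‖U - 1‖ := by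
  -- The C⋆-structure carries the operator norm, but the identity obtained mentions no norm; its
  -- trace gives Frobenius norms.
  obtain ⟨X, G, hX, hexp, hXG⟩ :=
    @exists_skewAdjoint_log_of_mem_unitary _ Matrix.instCStarAlgebra U
      ⟨hU, mul_eq_one_comm.mp hU⟩ (Matrix.finite_spectrum U)
  refine ⟨X, hX, hexp, ?_⟩
  have hXG' : Xᴴ * X + Gᴴ * G = ((Real.pi / 2) ^ 2 : ℂ) • ((U - 1)ᴴ * (U - 1)) := hXG
  have h : ‖X‖ ^ 2 + ‖G‖ ^ 2 = (Real.pi / 2 * ‖U - 1‖) ^ 2 := by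
    rw [mul_pow, frobenius_norm_sq_eq_trace, frobenius_norm_sq_eq_trace,
      frobenius_norm_sq_eq_trace, ← Complex.add_re, ← Matrix.trace_add, hXG', Matrix.trace_smul,
      smul_eq_mul, ← Complex.re_ofReal_mul]
    push_cast
    rfl
  refine (sq_le_sq₀ (norm_nonneg _) (by positivity)).mp ?_
  nlinarith [sq_nonneg ‖G‖]

theorem shortestGeodesic_le_of_square {n : ℕ} {Φ Ψ : Matrix (Fin n) (Fin n) ℂ}
    (hΦ : Φ ∈ stiefel n n) (hΨ : Ψ ∈ stiefel n n) :
    shortestGeodesic Φ Ψ ≤ ENNReal.ofReal (Real.pi / (2 * √2) * chordalDist Φ Ψ) := by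
  have h1 : Φᴴ * Φ = 1 := hΦ
  have h2 : Ψᴴ * Ψ = 1 := hΨ
  have h3 : Ψ * Ψᴴ = 1 := mul_eq_one_comm.mp h2
  have hU : (Φ * Ψᴴ)ᴴ * (Φ * Ψᴴ) = 1 := by
    rw [Matrix.conjTranspose_mul, Matrix.conjTranspose_conjTranspose, Matrix.mul_assoc,
      ← Matrix.mul_assoc Φᴴ, h1, Matrix.one_mul, h3]
  obtain ⟨X, hX, hexp, hle⟩ := exists_skewHermitian_log hU
  have hd : ‖Φ * Ψᴴ - 1‖ = chordalDist Φ Ψ := by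
    rw [chordalDist, ← norm_mul_stiefel_conjTranspose hΨ (Φ - Ψ), Matrix.sub_mul, h3]
  refine shortestGeodesic_le_of_exp_mul (X := X) ⟨hX, ?_⟩ ?_ ?_
  -- `Ψ` is invertible, so its isotropy algebra is trivial.
  · rintro W ⟨-, hW⟩
    have : W = 0 := by rw [← Matrix.mul_one W, ← h3, ← Matrix.mul_assoc, hW, Matrix.zero_mul]
    simp [this]
  · rw [hexp, Matrix.mul_assoc, h2, Matrix.mul_one]
  · rw [hd] at hle
    refine hle.trans_eq ?_
    field_simp

end UnitaryLogarithm

/-! ### Short geodesics between nearby points -/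

section LocalSurjectivity

variable {n k : ℕ}

/-- The Hermitian part of `Ψᴴ M`, the component of `M` normal to the Stiefel manifold at `Ψ`. -/
noncomputable def normalPart (Ψ M : Matrix (Fin n) (Fin k) ℂ) : Matrix (Fin k) (Fin k) ℂ :=
  (1 / 2 : ℂ) • (Ψᴴ * M + Mᴴ * Ψ)

/-- The component of `M` tangent to the Stiefel manifold at `Ψ`. -/
noncomputable def tangentPart (Ψ M : Matrix (Fin n) (Fin k) ℂ) : Matrix (Fin n) (Fin k) ℂ :=
  M - Ψ * normalPart Ψ M

theorem normalPart_sub (Ψ M N : Matrix (Fin n) (Fin k) ℂ) :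
    normalPart Ψ (M - N) = normalPart Ψ M - normalPart Ψ N := by
  simp only [normalPart, Matrix.conjTranspose_sub, Matrix.mul_sub, Matrix.sub_mul, ← smul_sub]
  congr 1
  abel

theorem tangentPart_sub (Ψ M N : Matrix (Fin n) (Fin k) ℂ) :
    tangentPart Ψ (M - N) = tangentPart Ψ M - tangentPart Ψ N := by
  simp only [tangentPart, normalPart_sub, Matrix.mul_sub]
  abel

theorem conjTranspose_normalPart (Ψ M : Matrix (Fin n) (Fin k) ℂ) :
    (normalPart Ψ M)ᴴ = normalPart Ψ M := by
  simp [normalPart, Matrix.conjTranspose_smul, add_comm]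

theorem norm_normalPart_le {Ψ : Matrix (Fin n) (Fin k) ℂ} (hΨ : Ψ ∈ stiefel n k)
    (M : Matrix (Fin n) (Fin k) ℂ) : ‖normalPart Ψ M‖ ≤ ‖M‖ := by
  have h1 : ‖Ψᴴ * M‖ ≤ ‖M‖ := norm_stiefel_conjTranspose_mul_le hΨ M
  have h2 : ‖Mᴴ * Ψ‖ ≤ ‖M‖ := by
    rw [← Matrix.frobenius_norm_conjTranspose M]
    exact norm_mul_stiefel_le hΨ _
  have h3 := norm_add_le (Ψᴴ * M) (Mᴴ * Ψ)
  rw [normalPart, norm_smul]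
  norm_num
  linarith

theorem norm_tangentPart_le {Ψ : Matrix (Fin n) (Fin k) ℂ} (hΨ : Ψ ∈ stiefel n k)
    (M : Matrix (Fin n) (Fin k) ℂ) : ‖tangentPart Ψ M‖ ≤ 2 * ‖M‖ := by
  have h1 := norm_sub_le M (Ψ * normalPart Ψ M)
  rw [norm_stiefel_mul hΨ] at h1
  rw [tangentPart]
  linarith [norm_normalPart_le hΨ M]

theorem tangentPart_isTangent {Ψ : Matrix (Fin n) (Fin k) ℂ} (hΨ : Ψ ∈ stiefel n k)
    (M : Matrix (Fin n) (Fin k) ℂ) :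
    (Ψᴴ * tangentPart Ψ M)ᴴ = -(Ψᴴ * tangentPart Ψ M) := by
  have h1 : Ψᴴ * Ψ = 1 := hΨ
  have h2 : Ψᴴ * tangentPart Ψ M = (1 / 2 : ℂ) • (Ψᴴ * M - Mᴴ * Ψ) := by
    rw [tangentPart, Matrix.mul_sub, ← Matrix.mul_assoc, h1, Matrix.one_mul, normalPart]
    module
  rw [h2]
  simp [Matrix.conjTranspose_smul, ← smul_neg]

/-- The horizontal element generating the tangent part of `M`. -/
noncomputable def horizontalPart (Ψ M : Matrix (Fin n) (Fin k) ℂ) : Matrix (Fin n) (Fin n) ℂ :=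
  horizontalLift Ψ (tangentPart Ψ M)

theorem horizontalPart_sub (Ψ M N : Matrix (Fin n) (Fin k) ℂ) :
    horizontalPart Ψ (M - N) = horizontalPart Ψ M - horizontalPart Ψ N := by
  rw [horizontalPart, tangentPart_sub, horizontalLift_sub]; rfl

theorem norm_horizontalPart_le {Ψ : Matrix (Fin n) (Fin k) ℂ} (hΨ : Ψ ∈ stiefel n k)
    (M : Matrix (Fin n) (Fin k) ℂ) : ‖horizontalPart Ψ M‖ ≤ 4 * ‖M‖ := by
  have := norm_horizontalLift_le hΨ (tangentPart Ψ M)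
  have h2 := norm_tangentPart_le hΨ M
  rw [horizontalPart]
  linarith

theorem horizontalPart_mul_add {Ψ : Matrix (Fin n) (Fin k) ℂ} (hΨ : Ψ ∈ stiefel n k)
    (M : Matrix (Fin n) (Fin k) ℂ) : horizontalPart Ψ M * Ψ + Ψ * normalPart Ψ M = M := by
  rw [horizontalPart, horizontalLift_mul hΨ (tangentPart_isTangent hΨ M), tangentPart]
  abel

/-- A chart of the matrices around `Ψ`: move along the geodesic generated by the tangent part,
then stretch by the normal part. -/
noncomputable def geodesicChart (Ψ M : Matrix (Fin n) (Fin k) ℂ) : Matrix (Fin n) (Fin k) ℂ :=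
  NormedSpace.exp (horizontalPart Ψ M) * Ψ * (1 + normalPart Ψ M)

theorem geodesicChart_zero (Ψ : Matrix (Fin n) (Fin k) ℂ) : geodesicChart Ψ 0 = Ψ := by
  simp [geodesicChart, horizontalPart, tangentPart, normalPart, horizontalLift]

/-- The linear part of the chart is the identity; what remains is the linearization error of `exp`
and two products that are small near `0`. -/
theorem geodesicChart_sub_sub {Ψ : Matrix (Fin n) (Fin k) ℂ} (hΨ : Ψ ∈ stiefel n k)
    (M N : Matrix (Fin n) (Fin k) ℂ) :
    geodesicChart Ψ M - geodesicChart Ψ N - (M - N) =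
      (NormedSpace.exp (horizontalPart Ψ M) - NormedSpace.exp (horizontalPart Ψ N) -
          (horizontalPart Ψ M - horizontalPart Ψ N)) * Ψ +
        (NormedSpace.exp (horizontalPart Ψ M) - NormedSpace.exp (horizontalPart Ψ N)) *
          (Ψ * normalPart Ψ M) +
        (NormedSpace.exp (horizontalPart Ψ N) - 1) *
          (Ψ * (normalPart Ψ M - normalPart Ψ N)) := by
  conv_lhs => rw [← horizontalPart_mul_add hΨ (M - N), horizontalPart_sub, normalPart_sub]
  simp only [geodesicChart, Matrix.mul_add, Matrix.mul_sub, Matrix.sub_mul, Matrix.mul_one,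
    Matrix.one_mul, Matrix.mul_assoc]
  abel

theorem norm_geodesicChart_sub_sub_le {Ψ : Matrix (Fin n) (Fin k) ℂ} (hΨ : Ψ ∈ stiefel n k)
    {c ε : ℝ} (hc : 0 ≤ c)
    (hexp : ∀ X Y : Matrix (Fin n) (Fin n) ℂ, ‖X‖ ≤ 4 * ε → ‖Y‖ ≤ 4 * ε →
      ‖NormedSpace.exp X - NormedSpace.exp Y - (X - Y)‖ ≤ c * ‖X - Y‖)
    {M N : Matrix (Fin n) (Fin k) ℂ} (hM : ‖M‖ ≤ ε) (hN : ‖N‖ ≤ ε) :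
    ‖geodesicChart Ψ M - geodesicChart Ψ N - (M - N)‖ ≤
      (4 * c + 8 * (1 + c) * ε) * ‖M - N‖ := by
  have hε : 0 ≤ ε := (norm_nonneg _).trans hM
  have hlip : ∀ X Y : Matrix (Fin n) (Fin n) ℂ, ‖X‖ ≤ 4 * ε → ‖Y‖ ≤ 4 * ε →
      ‖NormedSpace.exp X - NormedSpace.exp Y‖ ≤ (1 + c) * ‖X - Y‖ := fun X Y hX hY => by
    have h1 := hexp X Y hX hY
    have h2 := norm_sub_norm_le (NormedSpace.exp X - NormedSpace.exp Y) (X - Y)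
    linarith
  have hX := (norm_horizontalPart_le hΨ M).trans (by linarith : 4 * ‖M‖ ≤ 4 * ε)
  have hY := (norm_horizontalPart_le hΨ N).trans (by linarith : 4 * ‖N‖ ≤ 4 * ε)
  have hXY : ‖horizontalPart Ψ M - horizontalPart Ψ N‖ ≤ 4 * ‖M - N‖ := by
    rw [← horizontalPart_sub]; exact norm_horizontalPart_le hΨ _
  have hST : ‖normalPart Ψ M - normalPart Ψ N‖ ≤ ‖M - N‖ := by
    rw [← normalPart_sub]; exact norm_normalPart_le hΨ _
  have hS : ‖normalPart Ψ M‖ ≤ ε := (norm_normalPart_le hΨ M).trans hM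
  have hE : ‖NormedSpace.exp (horizontalPart Ψ N) - 1‖ ≤ (1 + c) * (4 * ε) := by
    have h0 := hlip (horizontalPart Ψ N) 0 hY (by rw [norm_zero]; positivity)
    rw [NormedSpace.exp_zero, sub_zero] at h0
    exact h0.trans (by gcongr)
  rw [geodesicChart_sub_sub hΨ]
  refine (norm_add₃_le).trans ?_
  have t1 := (norm_mul_stiefel_le hΨ _).trans (hexp _ _ hX hY)
  have t2 := Matrix.frobenius_norm_mul
    (NormedSpace.exp (horizontalPart Ψ M) - NormedSpace.exp (horizontalPart Ψ N))
    (Ψ * normalPart Ψ M)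
  have t3 := Matrix.frobenius_norm_mul (NormedSpace.exp (horizontalPart Ψ N) - 1)
    (Ψ * (normalPart Ψ M - normalPart Ψ N))
  rw [norm_stiefel_mul hΨ] at t2 t3
  calc _ ≤ c * (4 * ‖M - N‖) + (1 + c) * (4 * ‖M - N‖) * ε + (1 + c) * (4 * ε) * ‖M - N‖ := by
        refine add_le_add (add_le_add (t1.trans ?_) (t2.trans ?_)) (t3.trans ?_)
        · gcongr
        · have := hlip _ _ hX hY
          gcongr
          exact this.trans (by gcongr)
        · gcongr
    _ = _ := by ring

/-- A perturbation of the identity with Lipschitz constant `1/2` maps the `ε`-ball onto at least the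
`(1 - 1/2) ε`-ball about the image of its centre. The radius does not depend on `Ψ`. -/
theorem exists_geodesicChart_eq {Ψ : Matrix (Fin n) (Fin k) ℂ} (hΨ : Ψ ∈ stiefel n k)
    {ε : ℝ} (hε : 0 ≤ ε) (hε' : ε ≤ 1 / 64)
    (hexp : ∀ X Y : Matrix (Fin n) (Fin n) ℂ, ‖X‖ ≤ 4 * ε → ‖Y‖ ≤ 4 * ε →
      ‖NormedSpace.exp X - NormedSpace.exp Y - (X - Y)‖ ≤ 1 / 32 * ‖X - Y‖)
    {Φ : Matrix (Fin n) (Fin k) ℂ} (hΦ : ‖Φ - Ψ‖ ≤ ε / 2) :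
    ∃ M, ‖M‖ ≤ ε ∧ geodesicChart Ψ M = Φ := by
  have happ : ApproximatesLinearOn (geodesicChart Ψ)
      (ContinuousLinearMap.id ℝ (Matrix (Fin n) (Fin k) ℂ)) (Metric.closedBall 0 ε) (1 / 2) := by
    intro M hM N hN
    rw [mem_closedBall_zero_iff] at hM hN
    -- With `c = 1/32` and `ε ≤ 1/64` the constant is at most `1/8 + 33/256 < 1/2`.
    refine (norm_geodesicChart_sub_sub_le hΨ (by norm_num) hexp hM hN).trans ?_
    push_cast
    gcongr
    linarith
  let inv : (ContinuousLinearMap.id ℝ (Matrix (Fin n) (Fin k) ℂ)).NonlinearRightInverse :=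
    { toFun := id
      nnnorm := 1
      bound' := fun y => by simp
      right_inv' := fun y => rfl }
  obtain ⟨M, hM, hMΦ⟩ := happ.surjOn_closedBall_of_nonlinearRightInverse inv hε subset_rfl
    (show Φ ∈ _ by
      rw [geodesicChart_zero, mem_closedBall_iff_norm]
      refine hΦ.trans_eq ?_
      change _ = (((1 : NNReal) : ℝ)⁻¹ - ((1 / 2 : NNReal) : ℝ)) * ε
      push_cast
      ring)
  exact ⟨M, mem_closedBall_zero_iff.mp hM, hMΦ⟩

/-- The Gram matrix of the chart value is `(1 + S)²`. If it is `1`, then `2 S = -S²`, which forces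
`S = 0` when `‖S‖ ≤ 1`. -/
theorem normalPart_eq_zero_of_geodesicChart_mem {Ψ : Matrix (Fin n) (Fin k) ℂ}
    (hΨ : Ψ ∈ stiefel n k) {M : Matrix (Fin n) (Fin k) ℂ} (hM : ‖M‖ ≤ 1)
    (h : geodesicChart Ψ M ∈ stiefel n k) : normalPart Ψ M = 0 := by
  set S := normalPart Ψ M with hS
  have hX : horizontalPart Ψ M ∈ skewHermitian n :=
    (horizontalLift_mem_horizontal (tangentPart_isTangent hΨ M)).1
  have hE : (NormedSpace.exp (horizontalPart Ψ M) * Ψ)ᴴ *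
      (NormedSpace.exp (horizontalPart Ψ M) * Ψ) = 1 := exp_mul_mem_stiefel hX hΨ
  have h1 : (geodesicChart Ψ M)ᴴ * geodesicChart Ψ M = 1 := h
  have hSH : Sᴴ = S := conjTranspose_normalPart Ψ M
  rw [geodesicChart, Matrix.conjTranspose_mul, Matrix.mul_assoc, ← Matrix.mul_assoc _ᴴ _ (1 + _),
    hE, Matrix.one_mul, Matrix.conjTranspose_add, Matrix.conjTranspose_one, ← hS, hSH] at h1
  have h2 : (2 : ℂ) • S = -(S * S) := by
    have : (1 + S) * (1 + S) = 1 + (2 : ℂ) • S + S * S := by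
      rw [two_smul]; noncomm_ring
    rw [this] at h1
    rw [eq_neg_iff_add_eq_zero]
    have h3 := sub_eq_zero.mpr h1
    rw [← h3]; abel
  have h3 : 2 * ‖S‖ ≤ ‖S‖ * ‖S‖ := by
    have := congrArg norm h2
    rw [norm_smul, norm_neg] at this
    calc 2 * ‖S‖ = ‖S * S‖ := by simpa using this
      _ ≤ _ := Matrix.frobenius_norm_mul S S
  have h4 : ‖S‖ ≤ 1 := (norm_normalPart_le hΨ M).trans hM
  have h5 : ‖S‖ = 0 := by nlinarith [norm_nonneg S]
  exact norm_eq_zero.mp h5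

/-- Nearby points of the Stiefel manifold are joined by a short geodesic, uniformly. -/
theorem exists_horizontal_exp_mul_eq (n k : ℕ) : ∃ δ > 0,
    ∀ Φ ∈ stiefel n k, ∀ Ψ ∈ stiefel n k, ‖Φ - Ψ‖ ≤ δ →
      ∃ X ∈ horizontal Ψ, NormedSpace.exp X * Ψ = Φ ∧ 15 * ‖X‖ ≤ 32 * ‖Φ - Ψ‖ := by
  obtain ⟨ε₀, hε₀, hexp₀⟩ := exp_matrix_approximates (n := n) (c := 1 / 32) (by norm_num)
  set ε := min (ε₀ / 4) (1 / 64) with hεdef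
  have hε : 0 < ε := by positivity
  have hle : 4 * ε ≤ ε₀ := by linarith [min_le_left (ε₀ / 4) (1 / 64)]
  have hexp : ∀ X Y : Matrix (Fin n) (Fin n) ℂ, ‖X‖ ≤ 4 * ε → ‖Y‖ ≤ 4 * ε →
      ‖NormedSpace.exp X - NormedSpace.exp Y - (X - Y)‖ ≤ 1 / 32 * ‖X - Y‖ :=
    fun X Y hX hY => hexp₀ X Y (hX.trans hle) (hY.trans hle)
  refine ⟨ε / 2, by positivity, fun Φ hΦ Ψ hΨ hd => ?_⟩
  obtain ⟨M, hM, rfl⟩ := exists_geodesicChart_eq hΨ hε.le (min_le_right _ _) hexp hd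
  have hM1 : ‖M‖ ≤ 1 := hM.trans ((min_le_right _ _).trans (by norm_num))
  have hS := normalPart_eq_zero_of_geodesicChart_mem hΨ hM1 hΦ
  have hchart : geodesicChart Ψ M = NormedSpace.exp (horizontalPart Ψ M) * Ψ := by
    rw [geodesicChart, hS, add_zero, Matrix.mul_one]
  have hXM := horizontalPart_mul_add hΨ M
  rw [hS, Matrix.mul_zero, add_zero] at hXM
  have htan : tangentPart Ψ M = M := by rw [tangentPart, hS, Matrix.mul_zero, sub_zero]
  -- As `M` is now tangent, the general factor `4` improves to `2`, which the final constant
  -- requires.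
  have hX2 : ‖horizontalPart Ψ M‖ ≤ 2 * ‖M‖ := by
    have := norm_horizontalLift_le hΨ (tangentPart Ψ M)
    rwa [htan, ← htan, ← horizontalPart, htan] at this
  refine ⟨horizontalPart Ψ M, horizontalLift_mem_horizontal (tangentPart_isTangent hΨ M),
    hchart.symm, ?_⟩
  -- Multiplied by `Ψ`, this gives `‖Φ - Ψ - M‖ ≤ ‖X‖ / 32 ≤ ‖M‖ / 16`, with `X` the horizontal part
  -- and `Φ` the chart value. Hence `15 ‖M‖ ≤ 16 ‖Φ - Ψ‖`.
  have h0 := hexp (horizontalPart Ψ M) 0 (hX2.trans (by linarith)) (by rw [norm_zero]; positivity)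
  rw [NormedSpace.exp_zero, sub_zero] at h0
  have h1 := (norm_mul_stiefel_le hΨ _).trans h0
  rw [Matrix.sub_mul, Matrix.sub_mul, Matrix.one_mul, hXM, ← hchart] at h1
  have h2 := norm_sub_norm_le M (geodesicChart Ψ M - Ψ)
  rw [norm_sub_rev M] at h2
  linarith

theorem exists_shortestGeodesic_le (n k : ℕ) : ∃ δ > 0,
    ∀ Φ ∈ stiefel n k, ∀ Ψ ∈ stiefel n k, chordalDist Φ Ψ ≤ δ →
      shortestGeodesic Φ Ψ ≤ ENNReal.ofReal (Real.pi / 2 * chordalDist Φ Ψ) := by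
  obtain ⟨δ, hδ, h⟩ := exists_horizontal_exp_mul_eq n k
  refine ⟨δ, hδ, fun Φ hΦ Ψ hΨ hd => ?_⟩
  obtain ⟨X, hX, hexp, hle⟩ := h Φ hΦ Ψ hΨ hd
  refine shortestGeodesic_le_of_exp_mul hX hexp ?_
  have h1 : (32 / 15 : ℝ) ≤ √2 * (Real.pi / 2) := by
    have h2 : (1.4 : ℝ) ≤ √2 := Real.le_sqrt_of_sq_le (by norm_num)
    nlinarith [Real.pi_gt_d2]
  rw [← mul_assoc]
  calc ‖X‖ ≤ 32 / 15 * ‖Φ - Ψ‖ := by linarith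
    _ ≤ _ := by
      rw [chordalDist]
      gcongr

end LocalSurjectivity

/-! ### Assembly of the three bounds -/

theorem mainTheorem4 (n k : ℕ) :
    (∀ Φ ∈ stiefel n k, ∀ Ψ ∈ stiefel n k,
      ENNReal.ofReal (1 / √2 * chordalDist Φ Ψ) ≤ geodesicDist Φ Ψ ∧
        geodesicDist Φ Ψ ≤ shortestGeodesic Φ Ψ) ∧
    (k = n → ∀ Φ ∈ stiefel n k, ∀ Ψ ∈ stiefel n k,
      geodesicDist Φ Ψ ≤ ENNReal.ofReal (Real.pi / (2 * √2) * chordalDist Φ Ψ) ∧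
        shortestGeodesic Φ Ψ ≤ ENNReal.ofReal (Real.pi / (2 * √2) * chordalDist Φ Ψ)) ∧
    (2 * k ≤ n → ∀ α : ℝ, Real.pi / 2 < α → ∃ δ : ℝ, 0 < δ ∧
      ∀ Φ ∈ stiefel n k, ∀ Ψ ∈ stiefel n k, chordalDist Φ Ψ ≤ δ →
        geodesicDist Φ Ψ ≤ ENNReal.ofReal (α * chordalDist Φ Ψ) ∧
          shortestGeodesic Φ Ψ ≤ ENNReal.ofReal (α * chordalDist Φ Ψ)) := by
  refine ⟨fun Φ _ Ψ hΨ => ⟨chordalDist_le_geodesicDist Φ Ψ, geodesicDist_le_shortestGeodesic Φ hΨ⟩,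
    ?_, fun _ α hα => ?_⟩
  · rintro rfl Φ hΦ Ψ hΨ
    have h := shortestGeodesic_le_of_square hΦ hΨ
    exact ⟨(geodesicDist_le_shortestGeodesic Φ hΨ).trans h, h⟩
  · obtain ⟨δ, hδ, h⟩ := exists_shortestGeodesic_le n k
    refine ⟨δ, hδ, fun Φ hΦ Ψ hΨ hd => ?_⟩
    have h1 : shortestGeodesic Φ Ψ ≤ ENNReal.ofReal (α * chordalDist Φ Ψ) :=
      (h Φ hΦ Ψ hΨ hd).trans (ENNReal.ofReal_le_ofReal
        (mul_le_mul_of_nonneg_right hα.le (norm_nonneg _)))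
    exact ⟨(geodesicDist_le_shortestGeodesic Φ hΨ).trans h1, h1⟩
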